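/- An edge-coloring of a finite graph $G$ is a map $c:E(G)\to\mathbb N$ (not necessarily proper). A subgraph is rainbow if its edges have pairwise different colors. Let $\mathrm{ar}(G,H)$ be the maximum number of colors in an edge-coloring of $G$ without a rainbow copy of $H$, and let $\mathrm{ex}(G,H)$ be the maximum number of edges in a subgraph of $G$ without a copy of $H$. Let $K_r^t$ be the complete $r$-partite graph with all partite sets $U_1,\dots,U_r$ of size $t$, where $U_i=\{u_i^1,\dots,u_i^t\}$; let $K_r$ have vertices $v_1,\dots,v_r$; and let $T_{r,m}$ be the Turán graph, i.e. the complete $m$-partite graph on $r$ vertices whose part sizes pairwise differ by at most one. A color $a$ of an edge-coloring of $K_r$ is saturated by $v$ if $a$ occurs and every edge of color $a$ is incident to $v$. The blow-up of an edge-coloring $c$ of $K_r$ is the following coloring of $K_r^t$ (determined up to renaming colors). For an edge $u_i^su_j^{s'}$ with $a=c(v_iv_j)$: if $a$ is saturated by no vertex, the edge receives color $a$; if $a$ is saturated by exactly one vertex, say $v_i$, it receives a color $a_s$; if $a$ is saturated by both $v_i$ and $v_j$, it receives a color $a_{s,s'}$. Here all the colors $a$, $a_s$, $a_{s,s'}$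 arising in this way are distinct. Theorem. For all integers $r\ge k\ge 4$ and $t\ge 1$, $$\mathrm{ar}(K_r^t,K_k)=\begin{cases} t^2\left(\binom k2-2\right)+t, & r=k,\\ t^2\,\mathrm{ex}(K_r,K_{k-1})+1, & r>k.\end{cases}$$ Moreover, when $r>k$ the value is attained by the blow-up of the Turán coloring: if an edge-coloring of $K_r$ has a rainbow spanning subgraph $T\cong T_{r,k-2}$ and gives all edges of $K_r$ outside $T$ one common color not used on $T$ (such colorings exist), then its blow-up is an edge-coloring of $K_r^t$ with no rainbow $K_k$ and with exactly $t^2\,\mathrm{ex}(K_r,K_{k-1})+1$ colors. -/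

import Mathlib

namespace AntiRamsey

open SimpleGraph

variable {V W C : Type*}

/-- The number of colors that an edge-coloring uses. -/
noncomputable def numColors {G : SimpleGraph V} (c : G.EdgeLabeling C) : ℕ :=
  (Set.range c).ncard

/-- The edge-colored graph `G` contains a copy of `H` whose edges have pairwise distinct colors. -/
def HasRainbowCopy {G : SimpleGraph V} (c : G.EdgeLabeling C) (H : SimpleGraph W) : Prop :=
  ∃ f : H.Copy G, Function.Injective (c.pullback f.toHom)

/-- The anti-Ramsey number `ar(G, H)`: the maximum number of colors in an edge-coloring
`E(G) → ℕ` without a rainbow copy of `H`. For finite `G` the set is bounded, so that a nonzero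
value of this supremum is a maximum. -/
noncomputable def antiRamseyNumber (G : SimpleGraph V) (H : SimpleGraph W) : ℕ :=
  sSup {n : ℕ | ∃ c : G.EdgeLabeling ℕ, ¬ HasRainbowCopy c H ∧ numColors c = n}

/-- The color `a` is saturated by `v`: it appears, and every edge of color `a` is incident
to `v`. -/
def Saturates {G : SimpleGraph V} (c : G.EdgeLabeling C) (v : V) (a : C) : Prop :=
  (∃ e, c e = a) ∧ ∀ e : G.edgeSet, c e = a → v ∈ (e : Sym2 V)

/-- The blow-up of a graph in which every vertex `v` is replaced by the `t` independent vertices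
`(v, s)`. The blow-up of the complete graph on `Fin r` is `completeEquipartiteGraph r t`. -/
abbrev blowUp (G : SimpleGraph V) (t : ℕ) : SimpleGraph (V × Fin t) :=
  G.comap Prod.fst

/-- The projection of a blow-up to the original graph. -/
def blowUpProj (G : SimpleGraph V) (t : ℕ) : blowUp G t →g G where
  toFun := Prod.fst
  map_rel' h := h

/-- The blow-up of an edge-coloring. An edge over an edge of color `a` receives the color `a`
together with the set of those of its ends that lie over a vertex saturating `a`. Thus a color
saturated by no vertex is kept, a color `b` saturated by exactly one vertex `v` is split into the
`t` colors `(b, {(v, s)})`, and a color saturated by two vertices `v`, `w` (the color of the single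
edge `vw`) is split into the `t ^ 2` colors `(b, {(v, s), (w, s')})`. -/
def blowUpColoring {G : SimpleGraph V} (c : G.EdgeLabeling C) (t : ℕ) :
    (blowUp G t).EdgeLabeling (C × Set (V × Fin t)) :=
  fun e => (c.pullback (blowUpProj G t) e,
    {u | u ∈ (e : Sym2 (V × Fin t)) ∧ Saturates c u.1 (c.pullback (blowUpProj G t) e)})

/-- A Turán coloring of `K_r` with `m` parts: there is a rainbow copy `T` of the Turán graph
`T_{r,m}`, and the edges outside `T` are exactly those having one extra common color. -/
def IsTuranColoring {r : ℕ} (m : ℕ) (c : (completeGraph (Fin r)).EdgeLabeling C) : Prop :=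
  ∃ T : SimpleGraph (Fin r), Nonempty (T ≃g turanGraph r m) ∧
    (∀ e e' : (completeGraph (Fin r)).edgeSet, (e : Sym2 (Fin r)) ∈ T.edgeSet →
      (e' : Sym2 (Fin r)) ∈ T.edgeSet → c e = c e' → e = e') ∧
    ∃ a : C, ∀ e : (completeGraph (Fin r)).edgeSet, c e = a ↔ (e : Sym2 (Fin r)) ∉ T.edgeSet

end AntiRamsey

/-! Upper bound: a transversal, one vertex from each part, induces a coloring of `K_r`. Weight each
of its colors by `t ^ s`, where `s ≤ 2` is the number of vertices saturating it; this is the number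
of colors into which the blow-up splits it. Over all `t ^ r` transversals, every color of `K_r^t`
collects weight at least `t ^ r` (`pow_le_sum_cylinder_weight`), so on some transversal the total
weight is at least the number of colors. That transversal has no rainbow `K_k` either, which reduces
the problem to a weighted count on `K_r`.

For `r = k` some color repeats: at most `r.choose 2 - 1` colors remain, and a repeated one has
weight at most `t`. For `r > k` put `m = k - 2` and `N = ex(K_r, K_{k-1})`, the size of the Turán
graph. The anti-Ramsey theorem for cliques (`exists_rainbow_of_turanNumber_lt`) leaves at most `N +
1` colors. One color of weight exponent `0`, or two of exponent at most `1`, bring the total down to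
`t ^ 2 * N + 1`. Otherwise at most one color repeats and its edges share a vertex; deleting that
vertex leaves a rainbow `K_{r-1}`, which contains `K_k`.

Lower bound: blow up a Turán coloring for `r > k`, and for `r = k` the coloring whose only
repetition is on two edges `xy`, `xz`. -/

namespace AntiRamsey

open SimpleGraph Finset

/-! ### Anti-Ramsey theorem for cliques -/

section RainbowCliques

variable {V C : Type*} [DecidableEq V]

/-- The unordered pairs of distinct elements of a finite set. -/
def pairs (A : Finset V) : Finset (Sym2 V) := {e ∈ A.sym2 | ¬ e.IsDiag}

/-- The colors that appear on the pairs of a finite set of vertices. -/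
def colorsOn [DecidableEq C] (c : Sym2 V → C) (A : Finset V) : Finset C := (pairs A).image c

/-- The pairs of the finite set `A` have pairwise distinct colors. -/
def IsRainbow (c : Sym2 V → C) (A : Finset V) : Prop := Set.InjOn c (pairs A)

theorem mk_mem_pairs {A : Finset V} {x y : V} : s(x, y) ∈ pairs A ↔ x ∈ A ∧ y ∈ A ∧ x ≠ y := by
  simp [pairs, and_assoc]

theorem mem_of_mem_pairs {A : Finset V} {e : Sym2 V} (he : e ∈ pairs A) {x : V} (hx : x ∈ e) :
    x ∈ A :=
  mem_sym2_iff.1 (mem_filter.1 he).1 x hx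

theorem not_isDiag_of_mem_pairs {A : Finset V} {e : Sym2 V} (he : e ∈ pairs A) : ¬ e.IsDiag :=
  (mem_filter.1 he).2

theorem pairs_mono {A B : Finset V} (h : A ⊆ B) : pairs A ⊆ pairs B :=
  filter_subset_filter _ (sym2_mono h)

theorem colorsOn_mono [DecidableEq C] (c : Sym2 V → C) {A B : Finset V} (h : A ⊆ B) :
    colorsOn c A ⊆ colorsOn c B :=
  image_subset_image (pairs_mono h)

theorem card_pairs (A : Finset V) : #(pairs A) = (#A).choose 2 := by
  rw [← Sym2.card_image_offDiag]
  congr 1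
  ext e
  induction e with | _ x y =>
  simp only [mk_mem_pairs, mem_image, mem_offDiag, Prod.exists, Function.uncurry_apply_pair,
    Sym2.eq_iff]
  constructor
  · exact fun h => ⟨x, y, h, .inl ⟨rfl, rfl⟩⟩
  · rintro ⟨a, b, h, ⟨rfl, rfl⟩ | ⟨rfl, rfl⟩⟩
    · exact h
    · exact ⟨h.2.1, h.1, h.2.2.symm⟩

theorem card_colorsOn_le [DecidableEq C] (c : Sym2 V → C) (A : Finset V) :
    #(colorsOn c A) ≤ (#A).choose 2 :=
  card_image_le.trans (card_pairs A).le

theorem isRainbow_pair (c : Sym2 V → C) (x y : V) : IsRainbow c {x, y} := by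
  have key : ∀ e ∈ pairs ({x, y} : Finset V), e = s(x, y) := by
    intro e he
    induction e with | _ a b =>
    simp only [mk_mem_pairs, mem_insert, mem_singleton] at he
    grind
  intro e he e' he' _
  rw [key e he, key e' he']

/-- The number of edges of the Turán graph with `n` vertices and `m` parts, as the sum of the
degrees into the set of the earlier vertices. -/
def turanNumber (m n : ℕ) : ℕ := ∑ i ∈ range n, (i - i / m)

theorem turanNumber_succ (m n : ℕ) : turanNumber m (n + 1) = turanNumber m n + (n - n / m) :=
  sum_range_succ _ _

theorem turanNumber_of_le {m n : ℕ} (h : n ≤ m) : turanNumber m n = n.choose 2 := by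
  induction n with
  | zero => rfl
  | succ n ih =>
    rw [turanNumber_succ, ih (by omega), Nat.div_eq_of_lt (by omega), Nat.choose_succ_succ' n 1]
    simp [add_comm]

theorem choose_two_le_turanNumber {m n : ℕ} (hm : 1 ≤ m) (h : n ≤ m + 1) :
    n.choose 2 ≤ turanNumber m n + 1 := by
  rcases h.lt_or_eq with h | rfl
  · rw [turanNumber_of_le (by omega)]; omega
  · rw [turanNumber_succ, turanNumber_of_le le_rfl, Nat.div_self (by omega),
      Nat.choose_succ_succ' m 1, Nat.choose_one_right]
    simp only [Nat.reduceAdd]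
    omega

variable [DecidableEq C]

/-- The colors on `A` all of whose pairs contain `v`. -/
def colorsAt (c : Sym2 V → C) (A : Finset V) (v : V) : Finset C :=
  colorsOn c A \ colorsOn c (A.erase v)

theorem colorsAt_subset_image (c : Sym2 V → C) (A : Finset V) (v : V) :
    colorsAt c A v ⊆ (A.erase v).image fun x => c s(v, x) := by
  intro a ha
  obtain ⟨ha, hav⟩ := mem_sdiff.1 ha
  obtain ⟨e, he, rfl⟩ := mem_image.1 ha
  by_cases hv : v ∈ e
  · obtain ⟨x, rfl⟩ := hv
    obtain ⟨-, hx, hne⟩ := mk_mem_pairs.1 he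
    exact mem_image.2 ⟨x, mem_erase.2 ⟨hne.symm, hx⟩, rfl⟩
  · refine absurd (mem_image_of_mem c ?_) hav
    induction e with | _ x y =>
    simp only [Sym2.mem_iff, not_or, mk_mem_pairs] at hv he ⊢
    exact ⟨mem_erase.2 ⟨Ne.symm hv.1, he.1⟩, mem_erase.2 ⟨Ne.symm hv.2, he.2.1⟩, he.2.2⟩

/-- A color lost on deleting `v` occurs only on edges at `v`; `R` keeps one neighbor for each such
color. -/
theorem exists_representatives_colorsAt (c : Sym2 V → C) (A : Finset V) (v : V) :
    ∃ R ⊆ A.erase v, Set.InjOn (fun x => c s(v, x)) R ∧ (∀ x ∈ R, c s(v, x) ∈ colorsAt c A v) ∧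
      #R = #(colorsAt c A v) := by
  obtain ⟨R, hR, hinj⟩ := Finset.exists_subset_injOn_image_eq_of_surjOn
    (A.erase v) (colorsAt c A v) (f := fun x => c s(v, x)) (by
      intro a ha
      exact_mod_cast colorsAt_subset_image c A v ha)
  refine ⟨R, hR, hinj.1, fun x hx => hinj.2 ▸ mem_image_of_mem _ hx, ?_⟩
  rw [← hinj.2, card_image_of_injOn hinj.1]

/-- The edges from `v` to `R` have distinct colors, none of which occurs away from `v`, so they
cannot clash with `Y`. -/
theorem IsRainbow.insert {c : Sym2 V → C} {A R Y : Finset V} {v : V} (hY : IsRainbow c Y)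
    (hRA : R ⊆ A.erase v) (hinj : Set.InjOn (fun x => c s(v, x)) R)
    (hR : ∀ x ∈ R, c s(v, x) ∈ colorsAt c A v) (hYR : Y ⊆ R) : IsRainbow c (insert v Y) := by
  have hvY : v ∉ Y := fun h => by simpa using hRA (hYR h)
  have key : ∀ e ∈ pairs (Insert.insert v Y), e ∈ pairs Y ∨ ∃ x ∈ Y, e = s(v, x) := by
    intro e he
    induction e with | _ a b =>
    simp only [mk_mem_pairs, mem_insert] at he ⊢
    obtain ⟨rfl | ha, rfl | hb, hne⟩ := he
    · exact absurd rfl hne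
    · exact .inr ⟨b, hb, rfl⟩
    · exact .inr ⟨a, ha, Sym2.eq_swap⟩
    · exact .inl ⟨ha, hb, hne⟩
  have sep : ∀ e ∈ pairs Y, ∀ x ∈ Y, c e ≠ c s(v, x) := by
    intro e he x hx h
    refine (mem_sdiff.1 (hR x (hYR hx))).2 ?_
    rw [← h]
    exact mem_image_of_mem c (pairs_mono (hYR.trans hRA) he)
  intro e he e' he' hee
  rcases key e he with h | ⟨x, hx, rfl⟩ <;> rcases key e' he' with h' | ⟨x', hx', rfl⟩
  · exact hY h h' hee
  · exact absurd hee (sep e h x' hx')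
  · exact absurd hee.symm (sep e' h' x hx)
  · rw [hinj (hYR hx) (hYR hx') hee]

/-- Picking `v` and passing to `R v` loses at most `q` vertices, namely those of `B v`. The greedy
choice succeeds unless `#A = m * q + 1`, one vertex short. Then a small `B v`, or two overlapping
ones, save the missing vertex; failing both, the sets `B v` partition `A` into classes of size `q`,
which is impossible. -/
theorem exists_rainbow_of_card_colorsAt {c : Sym2 V → C} {A : Finset V} {m q : ℕ} (hm : 2 ≤ m)
    (hq : 1 ≤ q) (hA : m + 2 ≤ #A) (hAq : m * q + 1 ≤ #A)
    (h : ∀ v ∈ A, #A ≤ #(colorsAt c A v) + q) :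
    ∃ K ⊆ A, #K = m + 2 ∧ IsRainbow c K := by
  choose R hRA hinj hR hcard using exists_representatives_colorsAt c A
  have hRA' : ∀ v, R v ⊆ A := fun v => (hRA v).trans (erase_subset _ _)
  have hvR : ∀ v, v ∉ R v := fun v hv => by simpa using hRA v hv
  set B : V → Finset V := fun v => A \ R v with hB
  have hBcard : ∀ v ∈ A, #(B v) ≤ q := by
    intro v hv
    have := card_sdiff_add_card_eq_card (hRA' v)
    have := h v hv
    have := hcard v
    simp only [hB]
    omega
  -- The final `2` are free: any single edge is rainbow.
  have greedy : ∀ j : ℕ, ∀ X ⊆ A, j * q + 2 ≤ #X → ∃ K ⊆ X, #K = j + 2 ∧ IsRainbow c K := by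
    intro j
    induction j with
    | zero =>
      intro X _ hX
      obtain ⟨K, hK, hK2⟩ := exists_subset_card_eq (show 2 ≤ #X by omega)
      obtain ⟨x, y, -, rfl⟩ := card_eq_two.1 hK2
      exact ⟨_, hK, by simpa using hK2, isRainbow_pair c x y⟩
    | succ j ih =>
      intro X hXA hX
      obtain ⟨v, hv⟩ : X.Nonempty := card_pos.1 (by omega)
      have hsub : X ⊆ (X ∩ R v) ∪ B v := by
        intro x hx
        have := hXA hx
        simp only [hB, mem_union, mem_inter, mem_sdiff]
        tauto
      have h1 := (card_le_card hsub).trans (card_union_le _ _)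
      have h2 := hBcard v (hXA hv)
      obtain ⟨K, hK, hK2, hK3⟩ := ih (X ∩ R v) (inter_subset_left.trans hXA) (by
        rw [add_mul] at hX; omega)
      have hKR : K ⊆ R v := hK.trans inter_subset_right
      refine ⟨insert v K, insert_subset hv (hK.trans inter_subset_left), ?_,
        hK3.insert (hRA v) (hinj v) (hR v) hKR⟩
      rw [card_insert_of_notMem fun hvK => hvR v (hKR hvK), hK2]
  by_cases hbig : m * q + 2 ≤ #A
  · exact greedy m A subset_rfl hbig
  have hn : #A = m * q + 1 := by omega
  have hq2 : 2 ≤ q := by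
    by_contra hlt
    obtain rfl : q = 1 := by omega
    omega
  by_cases hsmall : ∃ v ∈ A, #(B v) < q
  · obtain ⟨v, hv, hvq⟩ := hsmall
    obtain ⟨j, rfl⟩ : ∃ j, m = j + 1 := ⟨m - 1, by omega⟩
    have := card_sdiff_add_card_eq_card (hRA' v)
    obtain ⟨K, hK, hK2, hK3⟩ := greedy j (R v) (hRA' v) (by
      simp only [hB] at hvq
      rw [add_mul] at hn; omega)
    refine ⟨insert v K, insert_subset hv (hK.trans (hRA' v)), ?_,
      hK3.insert (hRA v) (hinj v) (hR v) hK⟩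
    rw [card_insert_of_notMem fun hvK => hvR v (hK hvK), hK2]
  -- Here `v` and `w` together lose at most `2 * q - 1` vertices, so `(m - 2) * q + 2` survive.
  by_cases hmeet : ∃ v ∈ A, ∃ w ∈ A, w ∉ B v ∧ ¬ Disjoint (B v) (B w)
  · obtain ⟨v, hv, w, hw, hwv, hdis⟩ := hmeet
    obtain ⟨j, rfl⟩ : ∃ j, m = j + 2 := ⟨m - 2, by omega⟩
    have hwR : w ∈ R v := by
      by_contra hcon
      exact hwv (mem_sdiff.2 ⟨hw, hcon⟩)
    have hsub : A ⊆ (R v ∩ R w) ∪ (B v ∪ B w) := by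
      intro x hx
      simp only [hB, mem_union, mem_inter, mem_sdiff]
      tauto
    have h1 := (card_le_card hsub).trans (card_union_le _ _)
    have h2 := card_union_add_card_inter (B v) (B w)
    have h3 : 1 ≤ #(B v ∩ B w) := card_pos.2 (not_disjoint_iff_nonempty_inter.1 hdis)
    have h4 := hBcard v hv
    have h5 := hBcard w hw
    obtain ⟨K, hK, hK2, hK3⟩ := greedy j (R v ∩ R w) (inter_subset_left.trans (hRA' v)) (by
      rw [add_mul] at hn; omega)
    have hKv : K ⊆ R v := hK.trans inter_subset_left
    have hKw : K ⊆ R w := hK.trans inter_subset_right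
    have hwK : insert w K ⊆ R v := insert_subset hwR hKv
    refine ⟨insert v (insert w K), insert_subset hv (hwK.trans (hRA' v)), ?_,
      (hK3.insert (hRA w) (hinj w) (hR w) hKw).insert (hRA v) (hinj v) (hR v) hwK⟩
    rw [card_insert_of_notMem fun hvK => hvR v (hwK hvK),
      card_insert_of_notMem fun hwK => hvR w (hKw hwK), hK2]
  -- All `B v` now have size exactly `q`, and `w ∉ B v` forces `B w` to be disjoint from `B v`.
  -- Hence they are equivalence classes and `q ∣ m * q + 1`, against `q ≥ 2`.
  exfalso
  push Not at hsmall hmeet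
  have hself : ∀ v ∈ A, v ∈ B v := fun v hv => mem_sdiff.2 ⟨hv, hvR v⟩
  have hBA : ∀ v, B v ⊆ A := fun v => sdiff_subset
  have hsymm : ∀ v ∈ A, ∀ w ∈ B v, v ∈ B w := by
    intro v hv w hw
    by_contra hcon
    exact disjoint_left.1 (hmeet w (hBA v hw) v hv hcon) (hself w (hBA v hw)) hw
  have hclass : ∀ v ∈ A, ∀ w ∈ B v, B w = B v := by
    intro v hv w hw
    have hwA := hBA v hw
    refine (eq_of_subset_of_card_le (fun x hx => ?_)
      ((hBcard w hwA).trans (hsmall v hv))).symm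
    by_contra hcon
    exact disjoint_left.1 (hmeet w hwA x (hBA v hx) hcon) (hsymm v hv w hw) (hsymm v hv x hx)
  have hsum := card_eq_sum_card_image B A
  have hfib : ∀ b ∈ A.image B, #{w ∈ A | B w = b} = q := by
    intro b hb
    obtain ⟨v, hv, rfl⟩ := mem_image.1 hb
    have : ({w ∈ A | B w = B v} : Finset V) = B v := by
      ext w
      rw [mem_filter]
      exact ⟨fun ⟨hw, h⟩ => h ▸ hself w hw, fun hw => ⟨hBA v hw, hclass v hv w hw⟩⟩
    rw [this]
    exact le_antisymm (hBcard v hv) (hsmall v hv)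
  rw [sum_congr rfl hfib, sum_const, smul_eq_mul, hn] at hsum
  have hdvd : q ∣ m * q + 1 := hsum ▸ dvd_mul_left _ _
  have := Nat.le_of_dvd one_pos ((Nat.dvd_add_right (dvd_mul_left q m)).1 hdvd)
  omega

/-- The anti-Ramsey theorem for cliques: a coloring of the pairs of an `n`-set with at least two
colors more than the Turán graph `T_{n,m}` has edges contains a rainbow clique on `m + 2`
vertices. -/
theorem exists_rainbow_of_turanNumber_lt {m : ℕ} (hm : 2 ≤ m) (c : Sym2 V → C) (A : Finset V)
    (h : turanNumber m #A + 2 ≤ #(colorsOn c A)) : ∃ K ⊆ A, #K = m + 2 ∧ IsRainbow c K := by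
  induction hn : #A generalizing A with
  | zero =>
    have := card_colorsOn_le c A
    rw [hn, Nat.choose_zero_succ] at this
    omega
  | succ n ih =>
    rw [hn, turanNumber_succ] at h
    by_cases hsmall : n ≤ m
    · have h1 := card_colorsOn_le c A
      have h2 := choose_two_le_turanNumber (m := m) (n := n + 1) (by omega) (by omega)
      rw [hn] at h1
      rw [turanNumber_succ] at h2
      omega
    -- Deleting a vertex that loses no more colors than the last Turán degree `n - n / m` preserves
    -- the excess of two colors.
    by_cases hv : ∃ v ∈ A, #(colorsAt c A v) ≤ n - n / m
    · obtain ⟨v, hv, hle⟩ := hv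
      have h1 : #(A.erase v) = n := by rw [card_erase_of_mem hv, hn]; rfl
      have h2 := card_sdiff_add_card_eq_card (colorsOn_mono c (erase_subset v A))
      change #(colorsAt c A v) + _ = _ at h2
      obtain ⟨K, hK, hK'⟩ := ih (A.erase v) (by rw [h1]; omega) h1
      exact ⟨K, hK.trans (erase_subset v A), hK'⟩
    · push Not at hv
      refine exists_rainbow_of_card_colorsAt (q := n / m) hm
        ((Nat.one_le_div_iff (by omega)).2 (by omega)) (by omega) ?_ fun v hvA => ?_
      · have := Nat.mul_div_le n m
        omega
      · have := hv v hvA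
        omega

end RainbowCliques

/-! ### Averaging over transversals -/

section Averaging

open Classical in
/-- A nonempty family of cylinders in `Fin n → Fin t` is given by the predicate `Q`, where `Q D φ`
says that the cylinder of the `ψ` which agree with `φ` on `D` belongs to it. If each point covered
by the family has weight `t ^ s`, where `s` is the number of coordinates common to the supports of
all cylinders through the point, then the total weight is at least the number of points. -/
theorem pow_le_sum_cylinder_weight {t n : ℕ} (Q : Finset (Fin n) → (Fin n → Fin t) → Prop)
    (hQ : ∀ D φ ψ, (∀ i ∈ D, φ i = ψ i) → Q D φ → Q D ψ) (hne : ∃ D φ, Q D φ) :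
    t ^ n ≤ ∑ φ, if ∃ D, Q D φ then t ^ #{v | ∀ D, Q D φ → v ∈ D} else 0 := by
  induction n with
  | zero =>
    obtain ⟨D, φ, h⟩ := hne
    refine le_trans ?_ (single_le_sum (fun _ _ => Nat.zero_le _) (mem_univ φ))
    rw [if_pos ⟨D, h⟩, univ_eq_empty, filter_empty, card_empty]
  | succ n ih =>
    -- The slice of the family at first coordinate `s`, with that coordinate dropped from the
    -- supports.
    let Q' (s : Fin t) (D' : Finset (Fin n)) (φ' : Fin n → Fin t) : Prop :=
      ∃ D, Q D (Fin.cons s φ') ∧ ∀ v, v ∈ D' ↔ v.succ ∈ D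
    have hQ' : ∀ s D' φ ψ, (∀ i ∈ D', φ i = ψ i) → Q' s D' φ → Q' s D' ψ := by
      rintro s D' φ ψ h ⟨D, hD, hDD'⟩
      refine ⟨D, hQ D _ _ (fun i => ?_) hD, hDD'⟩
      refine Fin.cases (by simp) (fun i hi => ?_) i
      simpa using h i ((hDD' i).2 hi)
    have hex : ∀ s φ', (∃ D', Q' s D' φ') ↔ ∃ D, Q D (Fin.cons s φ') := by
      intro s φ'
      refine ⟨fun ⟨_, D, hD, _⟩ => ⟨D, hD⟩, fun ⟨D, hD⟩ =>
        ⟨univ.filter fun v => v.succ ∈ D, D, hD, by simp⟩⟩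
    have hmem : ∀ s φ' v, (∀ D', Q' s D' φ' → v ∈ D') ↔ ∀ D, Q D (Fin.cons s φ') → v.succ ∈ D := by
      intro s φ' v
      refine ⟨fun h D hD => ?_, fun h D' ⟨D, hD, hDD'⟩ => (hDD' v).2 (h D hD)⟩
      simpa using h {v | v.succ ∈ D} ⟨D, hD, by simp⟩
    have hstep : ∀ s, (∃ φ' D, Q D (Fin.cons s φ')) → t ^ n ≤ ∑ φ' : Fin n → Fin t,
        if ∃ D, Q D (Fin.cons s φ') then t ^ #{v : Fin n | ∀ D, Q D (Fin.cons s φ') → v.succ ∈ D}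
        else 0 := by
      rintro s ⟨φ', D, hD⟩
      obtain ⟨D', hD'⟩ := (hex s φ').2 ⟨D, hD⟩
      simpa only [hex, hmem] using ih (Q' s) (hQ' s) ⟨D', φ', hD'⟩
    have hcard : ∀ φ : Fin (n + 1) → Fin t, #{v | ∀ D, Q D φ → v ∈ D} =
        (if ∀ D, Q D φ → 0 ∈ D then 1 else 0) + #{v : Fin n | ∀ D, Q D φ → v.succ ∈ D} := by
      intro φ
      simp only [card_filter, Fin.sum_univ_succ]
    rw [← (Fin.consEquiv fun _ => Fin t).sum_comp, Fintype.sum_prod_type]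
    change _ ≤ ∑ s, ∑ φ', if ∃ D, Q D (Fin.cons s φ') then
      t ^ #{v | ∀ D, Q D (Fin.cons s φ') → v ∈ D} else 0
    obtain ⟨D₀, φ₀, h₀⟩ := hne
    have ht : 0 < t := Fin.pos (φ₀ 0)
    -- A cylinder not constraining coordinate `0` meets all `t` slices, each contributing `t ^ n`.
    -- If every cylinder constrains it, one slice suffices, since coordinate `0` then adds a factor
    -- `t` to every weight.
    by_cases hfree : ∃ D φ, Q D φ ∧ 0 ∉ D
    · obtain ⟨D, φ, hD, h0⟩ := hfree
      have : ∑ _s : Fin t, t ^ n = t ^ (n + 1) := by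
        rw [sum_const, card_univ, Fintype.card_fin, smul_eq_mul, pow_succ, mul_comm]
      rw [← this]
      refine sum_le_sum fun s _ => (hstep s ⟨Fin.tail φ, D, ?_⟩).trans
        (sum_le_sum fun φ' _ => ?_)
      · refine hQ D φ _ (fun i => ?_) hD
        refine Fin.cases (fun h => absurd h h0) (fun i _ => ?_) i
        simp [Fin.tail]
      · split_ifs
        · rw [hcard]
          exact Nat.pow_le_pow_right ht (Nat.le_add_left _ _)
        · rfl
    · push Not at hfree
      refine le_trans ?_ (single_le_sum (fun _ _ => Nat.zero_le _) (mem_univ (φ₀ 0)))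
      have hs := hstep (φ₀ 0) ⟨Fin.tail φ₀, D₀, by simpa using h₀⟩
      calc t ^ (n + 1) = t ^ n * t := pow_succ _ _
        _ ≤ _ := Nat.mul_le_mul_right t hs
        _ ≤ _ := by
          rw [sum_mul]
          refine sum_le_sum fun φ' _ => ?_
          rw [ite_mul, zero_mul]
          split_ifs with h
          · rw [hcard, if_pos fun D => hfree D _, ← pow_succ, add_comm 1]
          · rfl

variable {C : Type*} [DecidableEq C]

/-- The set of the vertices that are contained in all pairs of color `a`. -/
def saturating {V : Type*} [DecidableEq V] [Fintype V] (d : Sym2 V → C) (a : C) : Finset V :=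
  {v | ∀ e ∈ pairs univ, d e = a → v ∈ e}

/-- The coloring of the pairs of parts that is induced by the transversal `φ`. -/
def transversalColoring {r t : ℕ} (c : Sym2 (Fin r × Fin t) → C) (φ : Fin r → Fin t) :
    Sym2 (Fin r) → C :=
  fun e => c (e.map fun i => (i, φ i))

/-- The transversals through a fixed edge form a cylinder supported on the two parts that it joins.
A part saturates the color on `φ` exactly when it lies in the supports of all the color's cylinders
through `φ`. -/
theorem pow_le_sum_saturating {r t : ℕ} (c : Sym2 (Fin r × Fin t) → C) {x y : Fin r × Fin t}
    (hxy : x.1 ≠ y.1) :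
    t ^ r ≤ ∑ φ, if c s(x, y) ∈ colorsOn (transversalColoring c φ) univ then
      t ^ #(saturating (transversalColoring c φ) (c s(x, y))) else 0 := by
  classical
  let Q (D : Finset (Fin r)) (φ : Fin r → Fin t) : Prop :=
    ∃ e ∈ pairs univ, transversalColoring c φ e = c s(x, y) ∧ ∀ v, v ∈ D ↔ v ∈ e
  have hex : ∀ φ, (∃ D, Q D φ) ↔ c s(x, y) ∈ colorsOn (transversalColoring c φ) univ := by
    intro φ
    rw [colorsOn, mem_image]
    exact ⟨fun ⟨_, e, he, hc, _⟩ => ⟨e, he, hc⟩,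
      fun ⟨e, he, hc⟩ => ⟨univ.filter (· ∈ e), e, he, hc, by simp⟩⟩
  have hsat : ∀ φ v, (∀ D, Q D φ → v ∈ D) ↔
      v ∈ saturating (transversalColoring c φ) (c s(x, y)) := by
    intro φ v
    simp only [saturating, mem_filter, mem_univ, true_and]
    refine ⟨fun h e he hc => ?_, fun h D ⟨e, he, hc, hD⟩ => (hD v).2 (h e he hc)⟩
    simpa using h (univ.filter (· ∈ e)) ⟨e, he, hc, by simp⟩
  have := pow_le_sum_cylinder_weight Q ?_ ?_
  · simpa only [hex, hsat, filter_univ_mem] using this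
  · rintro D φ ψ h ⟨e, he, hc, hD⟩
    refine ⟨e, he, ?_, hD⟩
    rw [← hc]
    simp only [transversalColoring]
    congr 1
    refine Sym2.map_congr fun v hv => ?_
    rw [h v ((hD v).2 hv)]
  · refine ⟨{x.1, y.1}, Function.update (fun _ => y.2) x.1 x.2, s(x.1, y.1),
      mk_mem_pairs.2 ⟨mem_univ _, mem_univ _, hxy⟩, ?_, by simp⟩
    simp [transversalColoring, Function.update_of_ne hxy.symm]

/-- Some transversal sees at least the average weighted number of colors. -/
theorem exists_transversal_card_le {r t : ℕ} (ht : 1 ≤ t) (c : Sym2 (Fin r × Fin t) → C)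
    (S : Finset C) (hS : ∀ a ∈ S, ∃ x y : Fin r × Fin t, x.1 ≠ y.1 ∧ c s(x, y) = a) :
    ∃ φ : Fin r → Fin t, #S ≤ ∑ a ∈ colorsOn (transversalColoring c φ) univ,
      t ^ #(saturating (transversalColoring c φ) a) := by
  have : Nonempty (Fin r → Fin t) := ⟨fun _ => ⟨0, ht⟩⟩
  have key : ∑ _φ : Fin r → Fin t, #S ≤ ∑ φ : Fin r → Fin t,
      ∑ a ∈ colorsOn (transversalColoring c φ) univ,
        t ^ #(saturating (transversalColoring c φ) a) := by
    calc ∑ _φ : Fin r → Fin t, #S = ∑ _a ∈ S, t ^ r := by simp [mul_comm]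
      _ ≤ ∑ a ∈ S, ∑ φ, if a ∈ colorsOn (transversalColoring c φ) univ then
          t ^ #(saturating (transversalColoring c φ) a) else 0 := by
        refine sum_le_sum fun a ha => ?_
        obtain ⟨x, y, hxy, rfl⟩ := hS a ha
        exact pow_le_sum_saturating c hxy
      _ = ∑ φ : Fin r → Fin t, ∑ a ∈ S, if a ∈ colorsOn (transversalColoring c φ) univ then
          t ^ #(saturating (transversalColoring c φ) a) else 0 := sum_comm
      _ ≤ _ := by
        refine sum_le_sum fun φ _ => ?_
        rw [← sum_filter]
        exact sum_le_sum_of_subset fun a ha => (mem_filter.1 ha).2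
  obtain ⟨φ, -, h⟩ := exists_le_of_sum_le univ_nonempty key
  exact ⟨φ, h⟩

end Averaging

/-! ### Weighted color counts on the complete graph -/

section UpperBound

variable {V C : Type*} [DecidableEq V] [Fintype V] [DecidableEq C]

theorem card_saturating_le_two {d : Sym2 V → C} {a : C} (ha : a ∈ colorsOn d univ) :
    #(saturating d a) ≤ 2 := by
  obtain ⟨e, he, rfl⟩ := mem_image.1 ha
  rw [← Sym2.card_toFinset_of_not_isDiag e (not_isDiag_of_mem_pairs he)]
  refine card_le_card fun v hv => ?_
  simpa using (mem_filter.1 hv).2 e he rfl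

theorem card_saturating_le_one {d : Sym2 V → C} {e e' : Sym2 V} (he : e ∈ pairs univ)
    (he' : e' ∈ pairs univ) (hne : e ≠ e') (h : d e = d e') : #(saturating d (d e)) ≤ 1 := by
  refine card_le_one.2 fun x hx y hy => ?_
  simp only [saturating, mem_filter, mem_univ, true_and] at hx hy
  by_contra hxy
  refine hne ?_
  rw [(Sym2.mem_and_mem_iff hxy).1 ⟨hx e he rfl, hy e he rfl⟩,
    (Sym2.mem_and_mem_iff hxy).1 ⟨hx e' he' h.symm, hy e' he' h.symm⟩]

theorem eq_of_card_saturating_eq_two {d : Sym2 V → C} {e e' : Sym2 V} (he : e ∈ pairs univ)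
    (he' : e' ∈ pairs univ) (h : d e = d e') (h2 : 1 < #(saturating d (d e))) : e = e' := by
  by_contra hne
  exact h2.not_ge (card_saturating_le_one he he' hne h)

theorem sum_pow_card_saturating_le_of_not_isRainbow {t : ℕ} (ht : 1 ≤ t) {d : Sym2 V → C}
    (hd : ¬ IsRainbow d univ) :
    ∑ a ∈ colorsOn d univ, t ^ #(saturating d a) ≤
      t ^ 2 * ((Fintype.card V).choose 2 - 2) + t := by
  simp only [IsRainbow, Set.InjOn, not_forall] at hd
  obtain ⟨e, he, e', he', h, hne⟩ := hd
  rw [mem_coe] at he he'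
  have hmem : d e ∈ colorsOn d univ := mem_image_of_mem d he
  have hcard : #(colorsOn d univ) ≤ (Fintype.card V).choose 2 - 1 := by
    rw [← card_univ, ← card_pairs, ← card_erase_of_mem he]
    refine (card_le_card fun a ha => ?_).trans (card_image_le (f := d))
    obtain ⟨e₁, he₁, rfl⟩ := mem_image.1 ha
    by_cases h1 : e₁ = e
    · exact mem_image.2 ⟨e', mem_erase.2 ⟨Ne.symm hne, he'⟩, h1 ▸ h.symm⟩
    · exact mem_image_of_mem d (mem_erase.2 ⟨h1, he₁⟩)
  rw [← sum_erase_add _ _ hmem]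
  refine add_le_add ?_ ?_
  · refine (sum_le_card_nsmul _ _ (t ^ 2) fun a ha => Nat.pow_le_pow_right ht
      (card_saturating_le_two (mem_of_mem_erase ha))).trans ?_
    rw [smul_eq_mul, mul_comm, card_erase_of_mem hmem]
    exact Nat.mul_le_mul_left _ (by omega)
  · exact (Nat.pow_le_pow_right ht (card_saturating_le_one he he' hne h)).trans_eq (pow_one t)

/-- With at most `N + 1` colors of weight at most `t ^ 2`, it is enough to find one color of weight
`1` or two of weight at most `t`. If neither exists, deleting one vertex makes everything rainbow.
-/
theorem sum_pow_card_saturating_le_turanNumber {t m : ℕ} (ht : 1 ≤ t) (hm : 2 ≤ m)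
    (hV : m + 2 < Fintype.card V) {d : Sym2 V → C}
    (hd : ∀ K : Finset V, #K = m + 2 → ¬ IsRainbow d K) :
    ∑ a ∈ colorsOn d univ, t ^ #(saturating d a) ≤
      t ^ 2 * turanNumber m (Fintype.card V) + 1 := by
  set N := turanNumber m (Fintype.card V)
  have hcard : #(colorsOn d univ) ≤ N + 1 := by
    by_contra hlt
    obtain ⟨K, -, hK, hK'⟩ := exists_rainbow_of_turanNumber_lt hm d univ (by
      rw [card_univ]; omega)
    exact hd K hK hK'
  have hsum : ∀ S ⊆ colorsOn d univ, ∑ a ∈ S, t ^ #(saturating d a) ≤ t ^ 2 * #S := by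
    intro S hS
    rw [mul_comm, ← smul_eq_mul]
    exact sum_le_card_nsmul _ _ _ fun a ha => Nat.pow_le_pow_right ht
      (card_saturating_le_two (hS ha))
  by_cases hzero : ∃ a ∈ colorsOn d univ, #(saturating d a) = 0
  · obtain ⟨a, ha, ha0⟩ := hzero
    rw [← sum_erase_add _ _ ha, ha0, pow_zero]
    refine Nat.add_le_add_right ((hsum _ (erase_subset _ _)).trans ?_) 1
    rw [card_erase_of_mem ha]
    exact Nat.mul_le_mul_left _ (by omega)
  by_cases htwo : ∃ a ∈ colorsOn d univ, ∃ b ∈ colorsOn d univ, a ≠ b ∧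
      #(saturating d a) ≤ 1 ∧ #(saturating d b) ≤ 1
  · obtain ⟨a, ha, b, hb, hab, ha1, hb1⟩ := htwo
    have hb' : b ∈ (colorsOn d univ).erase a := mem_erase.2 ⟨hab.symm, hb⟩
    rw [← sum_erase_add _ _ ha, ← sum_erase_add _ _ hb']
    have h1 := hsum (((colorsOn d univ).erase a).erase b)
      ((erase_subset _ _).trans (erase_subset _ _))
    have h2 := (Nat.pow_le_pow_right ht ha1).trans_eq (pow_one t)
    have h3 := (Nat.pow_le_pow_right ht hb1).trans_eq (pow_one t)
    have h4 : 2 ≤ #(colorsOn d univ) := one_lt_card.2 ⟨a, ha, b, hb, hab⟩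
    have h5 : #(((colorsOn d univ).erase a).erase b) + 1 ≤ N := by
      rw [card_erase_of_mem hb', card_erase_of_mem ha]
      omega
    have h6 := Nat.mul_le_mul_left (t ^ 2) h5
    -- Two colors of weight `t` cost no more than one of weight `t ^ 2` and one of weight `1`.
    have h7 : 2 * t ≤ t ^ 2 + 1 := by
      zify
      nlinarith [sq_nonneg ((t : ℤ) - 1)]
    rw [mul_add, mul_one] at h6
    omega
  exfalso
  push Not at hzero htwo
  -- At most one color is not saturated by two vertices, and it is saturated by some `v`. Away from
  -- `v` every color belongs to a single edge, and `m + 2` vertices remain there.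
  obtain ⟨v, hv⟩ : ∃ v, ∀ a ∈ colorsOn d univ, #(saturating d a) ≤ 1 → v ∈ saturating d a := by
    by_cases hone : ∃ a ∈ colorsOn d univ, #(saturating d a) ≤ 1
    · obtain ⟨a, ha, ha1⟩ := hone
      obtain ⟨v, hv⟩ := card_pos.1 (Nat.pos_of_ne_zero (hzero a ha))
      refine ⟨v, fun b hb hb1 => ?_⟩
      by_cases hab : a = b
      · exact hab ▸ hv
      · exact absurd hb1 (htwo a ha b hb hab ha1).not_ge
    · push Not at hone
      obtain ⟨v⟩ : Nonempty V := Fintype.card_pos_iff.1 (by omega)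
      exact ⟨v, fun a ha h => absurd h (hone a ha).not_ge⟩
  obtain ⟨K, hK, hKcard⟩ := exists_subset_card_eq (s := univ.erase v) (n := m + 2) (by
    rw [card_erase_of_mem (mem_univ v), card_univ]; omega)
  refine hd K hKcard fun e he e' he' h => ?_
  have hev : v ∉ e := fun hve => by simpa using hK (mem_of_mem_pairs he hve)
  have heu := pairs_mono (subset_univ K) he
  refine eq_of_card_saturating_eq_two heu (pairs_mono (subset_univ K) he') h ?_
  by_contra hle
  exact hev ((mem_filter.1 (hv (d e) (mem_image_of_mem d heu) (not_lt.1 hle))).2 e heu rfl)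

end UpperBound

/-! ### Upper bounds for equipartite graphs -/

section Equipartite

variable {r t k : ℕ}

/-- An edge-coloring extended to all pairs of vertices by the color `0`. -/
noncomputable def extendColoring {V : Type*} {G : SimpleGraph V} (c : G.EdgeLabeling ℕ) :
    Sym2 V → ℕ :=
  -- The default may coincide with a genuine color; this is harmless, as distinct vertices of a
  -- transversal are always adjacent.
  open Classical in fun e => if h : e ∈ G.edgeSet then c ⟨e, h⟩ else 0

theorem extendColoring_of_mem {V : Type*} {G : SimpleGraph V} (c : G.EdgeLabeling ℕ) {e : Sym2 V}
    (he : e ∈ G.edgeSet) : extendColoring c e = c ⟨e, he⟩ :=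
  dif_pos he

theorem hasRainbowCopy_of_isRainbow_transversal
    {c : (completeEquipartiteGraph r t).EdgeLabeling ℕ} {φ : Fin r → Fin t} {K : Finset (Fin r)}
    (hK : #K = k) (h : IsRainbow (transversalColoring (extendColoring c) φ) K) :
    HasRainbowCopy c (completeGraph (Fin k)) := by
  let g : Fin k ↪ Fin r := (K.equivFinOfCardEq hK).symm.toEmbedding.trans (.subtype _)
  have hg : ∀ i, g i ∈ K := fun i => ((K.equivFinOfCardEq hK).symm i).2
  let f : completeGraph (Fin k) →g completeEquipartiteGraph r t :=
    { toFun := fun i => (g i, φ (g i))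
      map_rel' := fun {i j} hij => completeEquipartiteGraph_adj.2 (g.injective.ne hij.ne) }
  have hf : Function.Injective f := fun i j hij => g.injective (congrArg Prod.fst hij)
  refine ⟨f.toCopy hf, fun e e' hee => ?_⟩
  have key : ∀ e : (completeGraph (Fin k)).edgeSet, (e : Sym2 (Fin k)).map g ∈ pairs K ∧
      c.pullback f e = transversalColoring (extendColoring c) φ ((e : Sym2 (Fin k)).map g) := by
    rintro ⟨e, he⟩
    induction e with | _ i j =>
    refine ⟨mk_mem_pairs.2 ⟨hg i, hg j, g.injective.ne (mem_edgeSet _ |>.1 he).ne⟩, ?_⟩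
    exact (extendColoring_of_mem c (f.mapEdgeSet ⟨s(i, j), he⟩).2).symm
  refine Subtype.ext (Sym2.map.injective g.injective (h (key e).1 (key e').1 ?_))
  rw [← (key e).2, ← (key e').2]
  exact hee

/-- An edge-coloring of the complete equipartite graph has at most as many colors as one of its
transversals has weighted colors. -/
theorem exists_transversal_numColors_le (ht : 1 ≤ t)
    (c : (completeEquipartiteGraph r t).EdgeLabeling ℕ) :
    ∃ d : Sym2 (Fin r) → ℕ, numColors c ≤ ∑ a ∈ colorsOn d univ, t ^ #(saturating d a) ∧
      ∀ k, ∀ K : Finset (Fin r), #K = k → IsRainbow d K →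
        HasRainbowCopy c (completeGraph (Fin k)) := by
  classical
  obtain ⟨φ, hφ⟩ := exists_transversal_card_le ht (extendColoring c)
    (Set.finite_range (ι := (completeEquipartiteGraph r t).edgeSet) c).toFinset (by
    intro a ha
    obtain ⟨⟨e, he⟩, rfl⟩ := (Set.Finite.mem_toFinset _).1 ha
    induction e with | _ x y =>
    exact ⟨x, y, completeEquipartiteGraph_adj.1 he, extendColoring_of_mem c he⟩)
  refine ⟨transversalColoring (extendColoring c) φ, ?_, fun k K hK h =>
    hasRainbowCopy_of_isRainbow_transversal hK h⟩
  rwa [numColors, Set.ncard_eq_toFinset_card _ (Set.finite_range c)]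

theorem numColors_le_of_eq (ht : 1 ≤ t) {c : (completeEquipartiteGraph r t).EdgeLabeling ℕ}
    (hc : ¬ HasRainbowCopy c (completeGraph (Fin r))) :
    numColors c ≤ t ^ 2 * (r.choose 2 - 2) + t := by
  obtain ⟨d, hd, hK⟩ := exists_transversal_numColors_le ht c
  refine hd.trans ?_
  simpa using sum_pow_card_saturating_le_of_not_isRainbow ht
    fun h => hc (hK r univ (by simp) h)

theorem numColors_le_of_lt {m : ℕ} (ht : 1 ≤ t) (hm : 2 ≤ m) (hr : m + 2 < r)
    {c : (completeEquipartiteGraph r t).EdgeLabeling ℕ}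
    (hc : ¬ HasRainbowCopy c (completeGraph (Fin (m + 2)))) :
    numColors c ≤ t ^ 2 * turanNumber m r + 1 := by
  obtain ⟨d, hd, hK⟩ := exists_transversal_numColors_le ht c
  refine hd.trans ?_
  simpa using sum_pow_card_saturating_le_turanNumber ht hm (by simpa using hr)
    fun K hKm h => hc (hK _ K hKm h)

end Equipartite

/-! ### Size of the Turán graph -/

section Turan

/-- Exactly `n / m` of the earlier vertices lie in the part of `n`; for `m = 0` both sides equal
`n`. -/
theorem sum_range_mod_ne (m n : ℕ) :
    ∑ w ∈ range n, (if n % m ≠ w % m then 1 else 0) = n - n / m := by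
  have h : #{w ∈ range n | n % m = w % m} = n / m := by
    rcases m.eq_zero_or_pos with rfl | hm
    · simp only [Nat.mod_zero, Nat.div_zero, card_eq_zero, filter_eq_empty_iff, mem_range]
      omega
    · have := Nat.count_modEq_card n hm n
      rw [if_neg (lt_irrefl _), add_zero, Nat.count_eq_card_filter_range] at this
      rw [← this]
      congr 1
      ext w
      simp only [mem_filter, Nat.ModEq, eq_comm]
  rw [← card_filter, ← h]
  apply Nat.eq_sub_of_add_eq'
  rw [card_filter_add_card_filter_not, card_range]

theorem card_edgeFinset_turanGraph_eq_turanNumber (m n : ℕ) :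
    #(turanGraph n m).edgeFinset = turanNumber m n := by
  have hdouble : ∀ n, ∑ v ∈ range n, ∑ w ∈ range n, (if v % m ≠ w % m then 1 else 0) =
      2 * turanNumber m n := by
    intro n
    induction n with
    | zero => rfl
    | succ n ih =>
      rw [sum_range_succ, sum_range_succ]
      simp only [sum_range_succ (fun w => if _ % m ≠ w % m then 1 else 0), sum_add_distrib, ih]
      rw [turanNumber_succ, ← sum_range_mod_ne]
      simp only [ne_comm (a := _ % m) (b := n % m)]
      simp
      ring
  rw [← mul_right_inj' two_ne_zero, ← hdouble, ← sum_degrees_eq_twice_card_edges]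
  simp_rw [degree, neighborFinset_eq_filter, turanGraph_adj, card_filter]
  rw [← Fin.sum_univ_eq_sum_range fun v => ∑ w ∈ range n, if v % m ≠ w % m then 1 else 0]
  refine sum_congr rfl fun v _ => ?_
  rw [← Fin.sum_univ_eq_sum_range fun w => if v % m ≠ w % m then 1 else 0]

theorem extremalNumber_completeGraph {m : ℕ} (hm : 1 ≤ m) (r : ℕ) :
    extremalNumber r (completeGraph (Fin (m + 1))) = turanNumber m r := by
  have : Nontrivial (Fin (m + 1)) := Fin.nontrivial_iff_two_le.2 (by omega)
  rw [extremalNumber_top, card_edgeFinset_turanGraph_eq_turanNumber, Fintype.card_fin,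
    Nat.add_sub_cancel]

end Turan

/-! ### Extremal colorings -/

section LowerBound

variable {V W C : Type*}

theorem ncard_edgeSet_blowUp [Fintype V] (T : SimpleGraph V) (t : ℕ) :
    (blowUp T t).edgeSet.ncard = t ^ 2 * T.edgeSet.ncard := by
  classical
  rw [Set.ncard_eq_toFinset_card', Set.ncard_eq_toFinset_card']
  change #(blowUp T t).edgeFinset = t ^ 2 * #T.edgeFinset
  rw [← mul_right_inj' two_ne_zero, mul_left_comm, ← sum_degrees_eq_twice_card_edges,
    ← sum_degrees_eq_twice_card_edges, Fintype.sum_prod_type, mul_sum]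
  refine sum_congr rfl fun v _ => ?_
  have hdeg : ∀ s : Fin t, (blowUp T t).degree (v, s) = T.degree v * t := by
    intro s
    have : (blowUp T t).neighborFinset (v, s) = T.neighborFinset v ×ˢ univ := by
      ext x
      simp
    rw [degree, this, card_product, card_univ, Fintype.card_fin, degree]
  simp only [hdeg, sum_const, card_univ, Fintype.card_fin, smul_eq_mul]
  ring

theorem ncard_range_eq_add {α β : Type*} [Finite α] (f : α → β) (S : Set α)
    (h : ∀ x y, x ∈ S → f x = f y → x = y) :
    (Set.range f).ncard = S.ncard + (f '' Sᶜ).ncard := by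
  have hinj : Set.InjOn f S := fun x hx y _ hxy => h x y hx hxy
  rw [← hinj.ncard_image, ← Set.ncard_union_eq ?_ (Set.toFinite _) (Set.toFinite _),
    ← Set.image_union, Set.union_compl_self, Set.image_univ]
  rw [Set.disjoint_left]
  rintro _ ⟨x, hx, rfl⟩ ⟨y, hy, hxy⟩
  exact hy (h x y hx hxy.symm ▸ hx)

/-- If the edges of a subgraph `T` have unique colors, then there are as many colors as edges of
`T` and colors outside of `T` together. -/
theorem numColors_eq_add [Finite V] {G T : SimpleGraph V} (hT : T ≤ G) (c : G.EdgeLabeling C)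
    (h : ∀ e e' : G.edgeSet, (e : Sym2 V) ∈ T.edgeSet → c e = c e' → e = e') :
    numColors c = T.edgeSet.ncard + (c '' {e | (e : Sym2 V) ∉ T.edgeSet}).ncard := by
  have hcard : (Subtype.val ⁻¹' T.edgeSet : Set G.edgeSet).ncard = T.edgeSet.ncard := by
    rw [← Set.ncard_image_of_injective _ Subtype.val_injective, Subtype.image_preimage_coe,
      Set.inter_eq_right.2 (edgeSet_mono hT)]
  rw [← hcard]
  exact ncard_range_eq_add (α := G.edgeSet) c _ h

theorem bddAbove_numColors [Finite V] (G : SimpleGraph V) (H : SimpleGraph W) :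
    BddAbove {n : ℕ | ∃ c : G.EdgeLabeling ℕ, ¬ HasRainbowCopy c H ∧ numColors c = n} := by
  refine ⟨Nat.card G.edgeSet, ?_⟩
  rintro _ ⟨c, -, rfl⟩
  exact Finite.card_range_le (α := G.edgeSet) c

/-- A coloring with arbitrary colors can be recolored by natural numbers. -/
theorem exists_nat_coloring [Finite V] {G : SimpleGraph V} {H : SimpleGraph W}
    (c : G.EdgeLabeling C) (hc : ¬ HasRainbowCopy c H) :
    ∃ c' : G.EdgeLabeling ℕ, ¬ HasRainbowCopy c' H ∧ numColors c' = numColors c := by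
  have hfin : (Set.range c).Finite := Set.finite_range (ι := G.edgeSet) c
  obtain ⟨g, hg⟩ := Set.countable_iff_exists_injOn.1 hfin.countable
  refine ⟨c.compRight g, ?_, ?_⟩
  · rintro ⟨f, hf⟩
    refine hc ⟨f, fun e e' hee => hf ?_⟩
    exact congrArg g hee
  · rw [numColors, numColors, ← hg.ncard_image]
    congr 1
    exact Set.range_comp g c

theorem antiRamseyNumber_eq [Finite V] {G : SimpleGraph V} {H : SimpleGraph W} {n : ℕ}
    (hub : ∀ c : G.EdgeLabeling ℕ, ¬ HasRainbowCopy c H → numColors c ≤ n)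
    (c : G.EdgeLabeling C) (hc : ¬ HasRainbowCopy c H) (hn : numColors c = n) :
    antiRamseyNumber G H = n := by
  obtain ⟨c', hc', hn'⟩ := exists_nat_coloring c hc
  refine le_antisymm (csSup_le ⟨_, c', hc', rfl⟩ ?_)
    (le_csSup (bddAbove_numColors G H) ⟨c', hc', hn'.trans hn⟩)
  rintro _ ⟨c, hc, rfl⟩
  exact hub c hc

theorem exists_ne_eq_avoiding {α : Type*} [Fintype α] {m : ℕ} (κ : α → Fin m)
    (h : m + 1 < Fintype.card α) (v : α) : ∃ x y, x ≠ v ∧ y ≠ v ∧ x ≠ y ∧ κ x = κ y := by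
  classical
  obtain ⟨x, hx, y, hy, hxy, hκ⟩ := exists_ne_map_eq_of_card_lt_of_maps_to
    (s := univ.erase v) (t := univ) (f := κ) (by
      rw [card_erase_of_mem (mem_univ v), card_univ, card_univ, Fintype.card_fin]
      omega) (fun _ _ => mem_univ _)
  exact ⟨x, y, (mem_erase.1 hx).1, (mem_erase.1 hy).1, hxy, hκ⟩

theorem exists_isTuranColoring (r m : ℕ) :
    ∃ c : (completeGraph (Fin r)).EdgeLabeling ℕ, IsTuranColoring m c := by
  classical
  obtain ⟨g, hg⟩ := Countable.exists_injective_nat (Sym2 (Fin r))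
  refine ⟨fun e => if (e : Sym2 (Fin r)) ∈ (turanGraph r m).edgeSet then g e + 1 else 0,
    turanGraph r m, ⟨Iso.refl⟩, fun e e' he he' h => ?_, 0, fun e => ?_⟩
  · beta_reduce at h
    rw [if_pos he, if_pos he'] at h
    exact Subtype.ext (hg (Nat.succ_injective h))
  · beta_reduce
    split_ifs with he <;> simp [he]

/-- The vertices of the Turán graph are colored by their parts. -/
theorem exists_coloring_of_iso_turanGraph {T : SimpleGraph V} {r m : ℕ} (hm : 1 ≤ m)
    (g : T ≃g turanGraph r m) : ∃ κ : V → Fin m, ∀ x y, κ x = κ y → ¬ T.Adj x y := by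
  refine ⟨fun x => ⟨g x % m, Nat.mod_lt _ hm⟩, fun x y h hadj => ?_⟩
  exact turanGraph_adj.1 (g.map_adj_iff.2 hadj) (congrArg Fin.val h)

theorem ncard_edgeSet_of_iso_turanGraph {T : SimpleGraph V} {r m : ℕ}
    (g : T ≃g turanGraph r m) : T.edgeSet.ncard = turanNumber m r := by
  rw [← card_edgeFinset_turanGraph_eq_turanNumber, ← Nat.card_coe_set_eq,
    Nat.card_congr g.mapEdgeSet, Nat.card_eq_fintype_card, edgeFinset_card]

section TuranBlowUp

variable {r m t : ℕ} {c : (completeGraph (Fin r)).EdgeLabeling C} {T : SimpleGraph (Fin r)} {a : C}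

/-- A color occurring on a single edge is saturated by both ends, so the second component of the
blown-up color is the whole edge. -/
theorem blowUpColoring_injective_of_unique
    (huniq : ∀ e e' : (completeGraph (Fin r)).edgeSet, (e : Sym2 (Fin r)) ∈ T.edgeSet →
      c e = c e' → e = e')
    (e e' : (blowUp (completeGraph (Fin r)) t).edgeSet)
    (he : (e : Sym2 (Fin r × Fin t)) ∈ (blowUp T t).edgeSet)
    (h : blowUpColoring c t e = blowUpColoring c t e') : e = e' := by
  have hT : ((blowUpProj _ t).mapEdgeSet e : Sym2 (Fin r)) ∈ T.edgeSet := by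
    obtain ⟨e, he₁⟩ := e
    induction e with | _ x y => exact he
  have hproj : (blowUpProj _ t).mapEdgeSet e = (blowUpProj _ t).mapEdgeSet e' :=
    huniq _ _ hT (congrArg Prod.fst h)
  have hsat : ∀ e₁ : (blowUp (completeGraph (Fin r)) t).edgeSet,
      (blowUpProj _ t).mapEdgeSet e₁ = (blowUpProj _ t).mapEdgeSet e → ∀ u,
      u ∈ (blowUpColoring c t e₁).2 ↔ u ∈ (e₁ : Sym2 (Fin r × Fin t)) := by
    intro e₁ he₁ u
    refine ⟨fun hu => hu.1, fun hu => ⟨hu, ⟨_, rfl⟩, fun e₂ he₂ => ?_⟩⟩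
    rw [EdgeLabeling.pullback_apply, he₁] at he₂
    rw [← huniq _ _ hT he₂.symm, ← he₁]
    exact Sym2.mem_map.2 ⟨u, hu, rfl⟩
  refine Subtype.ext (Sym2.ext fun u => ?_)
  rw [← hsat e rfl, ← hsat e' hproj.symm, h]

theorem blowUpColoring_eq_of_notMem
    (hout : ∀ e : (completeGraph (Fin r)).edgeSet, c e = a ↔ (e : Sym2 (Fin r)) ∉ T.edgeSet)
    (hsat : ∀ v, ¬ Saturates c v a) (e : (blowUp (completeGraph (Fin r)) t).edgeSet)
    (he : (e : Sym2 (Fin r × Fin t)) ∉ (blowUp T t).edgeSet) :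
    blowUpColoring c t e = (a, ∅) := by
  have hT : ((blowUpProj _ t).mapEdgeSet e : Sym2 (Fin r)) ∉ T.edgeSet := by
    obtain ⟨e, he₁⟩ := e
    induction e with | _ x y => exact he
  have hcol : c.pullback (blowUpProj _ t) e = a := (hout _).2 hT
  refine Prod.ext hcol (Set.eq_empty_iff_forall_notMem.2 fun u hu => hsat u.1 ?_)
  rw [← hcol]
  exact hu.2

/-- The blow-up of a Turán coloring gives unique colors to the edges of a blow-up of the Turán
graph and one common color to the remaining edges. -/
theorem blowUp_turanColoring (hm : 1 ≤ m) (hr : m + 2 < r) (ht : 1 ≤ t)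
    (hc : IsTuranColoring m c) :
    ¬ HasRainbowCopy (G := completeEquipartiteGraph r t) (blowUpColoring c t)
        (completeGraph (Fin (m + 2))) ∧
      numColors (G := completeEquipartiteGraph r t) (blowUpColoring c t) =
        t ^ 2 * turanNumber m r + 1 := by
  obtain ⟨T, ⟨g⟩, hinj, a, hout⟩ := hc
  obtain ⟨κ, hκ⟩ := exists_coloring_of_iso_turanGraph hm g
  have huniq : ∀ e e' : (completeGraph (Fin r)).edgeSet, (e : Sym2 (Fin r)) ∈ T.edgeSet →
      c e = c e' → e = e' := by
    intro e e' he h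
    refine hinj e e' he ?_ h
    by_contra he'
    exact (hout e).1 (h.trans ((hout e').2 he')) he
  have hsat : ∀ v, ¬ Saturates c v a := by
    rintro v ⟨-, h⟩
    obtain ⟨x, y, hxv, hyv, hxy, hκxy⟩ := exists_ne_eq_avoiding κ (by simp; omega) v
    have := h ⟨s(x, y), hxy⟩ ((hout _).2 (hκ x y hκxy))
    rcases Sym2.mem_iff.1 this with rfl | rfl
    · exact hxv rfl
    · exact hyv rfl
  have hcommon := blowUpColoring_eq_of_notMem (t := t) hout hsat
  constructor
  · rintro ⟨f, hf⟩
    have hcol : ∀ i j (hij : i ≠ j), κ (f i).1 = κ (f j).1 →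
        (blowUpColoring c t).pullback f.toHom ⟨s(i, j), hij⟩ = (a, ∅) := fun i j hij h =>
      hcommon (f.toHom.mapEdgeSet ⟨s(i, j), hij⟩) (hκ _ _ h)
    -- Among `m + 2` vertices in `m` classes some pair shares a class, and still does after
    -- discarding `i`: two distinct edges get the common color. The `0` is an arbitrary vertex to
    -- avoid.
    obtain ⟨i, j, -, -, hij, hκij⟩ :=
      exists_ne_eq_avoiding (fun i => κ (f i).1) (by simp) 0
    obtain ⟨i', j', hi', hj', hij', hκij'⟩ :=
      exists_ne_eq_avoiding (fun i => κ (f i).1) (by simp) i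
    have := congrArg Subtype.val (hf ((hcol i j hij hκij).trans (hcol i' j' hij' hκij').symm))
    rcases Sym2.eq_iff.1 this with ⟨h, -⟩ | ⟨h, -⟩
    · exact hi' h.symm
    · exact hj' h.symm
  · have hle : blowUp T t ≤ completeEquipartiteGraph r t := fun _ _ h =>
      completeEquipartiteGraph_adj.2 (Adj.ne (G := T) h)
    rw [numColors_eq_add hle (blowUpColoring c t) (blowUpColoring_injective_of_unique huniq),
      ncard_edgeSet_blowUp, ncard_edgeSet_of_iso_turanGraph g]
    congr 1
    rw [Set.ncard_eq_one]
    refine ⟨(a, ∅), Set.eq_singleton_iff_unique_mem.2 ⟨?_, ?_⟩⟩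
    · obtain ⟨x, y, -, -, hxy, hκxy⟩ := exists_ne_eq_avoiding κ (by simp; omega) ⟨0, by omega⟩
      let e : (completeEquipartiteGraph r t).edgeSet := ⟨s((x, ⟨0, ht⟩), (y, ⟨0, ht⟩)), hxy⟩
      have he : (e : Sym2 (Fin r × Fin t)) ∉ (blowUp T t).edgeSet := hκ x y hκxy
      exact ⟨e, he, hcommon e he⟩
    · rintro _ ⟨e, he, rfl⟩
      exact hcommon e he

end TuranBlowUp

section Cherry

variable {r t : ℕ}

/-- The complete graph without the two edges that join `x` to `y` and to `z`. -/
def cherryCompl (x y z : V) : SimpleGraph V := (completeGraph V).deleteEdges {s(x, y), s(x, z)}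

theorem cherryCompl_adj {x y z u v : V} : (cherryCompl x y z).Adj u v ↔
    u ≠ v ∧ ¬ (s(u, v) = s(x, y) ∨ s(u, v) = s(x, z)) := by
  simp only [cherryCompl, deleteEdges_adj, top_adj, Set.mem_insert_iff, Set.mem_singleton_iff]

/-- The coloring of the blow-up of the complete graph in which the edges over `xy` and `xz` are
colored by their end over `x`, and the other edges have unique colors. -/
def cherryColoring (x y z : Fin r) (t : ℕ) :
    (completeEquipartiteGraph r t).EdgeLabeling (Set (Fin r × Fin t)) :=
  fun e => {u | u ∈ (e : Sym2 (Fin r × Fin t)) ∧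
    ((e : Sym2 (Fin r × Fin t)) ∈ (blowUp (cherryCompl x y z) t).edgeSet ∨ u.1 = x)}

theorem ncard_edgeSet_cherryCompl {x y z : Fin r} (hxy : x ≠ y) (hxz : x ≠ z) (hyz : y ≠ z) :
    (cherryCompl x y z).edgeSet.ncard = r.choose 2 - 2 := by
  have hne : s(x, y) ≠ s(x, z) := by simpa [hxz] using hyz
  rw [cherryCompl, edgeSet_deleteEdges, Set.ncard_sdiff, Set.ncard_pair hne,
    Set.ncard_eq_toFinset_card']
  · congr 1
    exact (card_edgeFinset_top_eq_card_choose_two (V := Fin r)).trans (by rw [Fintype.card_fin])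
  · rintro e (rfl | rfl)
    · exact hxy
    · exact hxz

theorem notMem_blowUp_cherryCompl {x y z : Fin r}
    {e : (completeEquipartiteGraph r t).edgeSet}
    (he : (e : Sym2 (Fin r × Fin t)) ∉ (blowUp (cherryCompl x y z) t).edgeSet) :
    ∃ s s', ∃ w, (w = y ∨ w = z) ∧ (e : Sym2 (Fin r × Fin t)) = s((x, s), (w, s')) := by
  obtain ⟨e, he₁⟩ := e
  induction e with | _ u v =>
  have hne : u.1 ≠ v.1 := he₁
  obtain ⟨u, s⟩ := u
  obtain ⟨v, s'⟩ := v
  have : s(u, v) = s(x, y) ∨ s(u, v) = s(x, z) := by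
    by_contra hcon
    exact he (cherryCompl_adj.2 ⟨hne, hcon⟩)
  simp only [Sym2.eq_iff] at this
  rcases this with (⟨rfl, rfl⟩ | ⟨rfl, rfl⟩) | (⟨rfl, rfl⟩ | ⟨rfl, rfl⟩)
  · exact ⟨s, s', v, .inl rfl, rfl⟩
  · exact ⟨s', s, u, .inl rfl, Sym2.eq_swap⟩
  · exact ⟨s, s', v, .inr rfl, rfl⟩
  · exact ⟨s', s, u, .inr rfl, Sym2.eq_swap⟩

theorem cherryColoring_of_notMem {x y z w : Fin r} (hxw : x ≠ w) {s s' : Fin t}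
    {e : (completeEquipartiteGraph r t).edgeSet}
    (he : (e : Sym2 (Fin r × Fin t)) ∉ (blowUp (cherryCompl x y z) t).edgeSet)
    (hs : (e : Sym2 (Fin r × Fin t)) = s((x, s), (w, s'))) :
    cherryColoring x y z t e = {(x, s)} := by
  ext u
  rw [Set.mem_singleton_iff]
  constructor
  · rintro ⟨hu, h⟩
    rw [hs, Sym2.mem_iff] at hu
    rcases hu with rfl | rfl
    · rfl
    · exact absurd (h.resolve_left he).symm hxw
  · rintro rfl
    exact ⟨hs ▸ Sym2.mem_mk_left _ _, .inr rfl⟩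

/-- Edges off the cherry are colored by their two ends and those over it by a singleton over `x`, so
the two kinds never collide. -/
theorem numColors_cherryColoring {x y z : Fin r} (hxy : x ≠ y) (hxz : x ≠ z) (hyz : y ≠ z) :
    numColors (cherryColoring x y z t) = t ^ 2 * (r.choose 2 - 2) + t := by
  have hle : blowUp (cherryCompl x y z) t ≤ completeEquipartiteGraph r t := fun _ _ h =>
    completeEquipartiteGraph_adj.2 (Adj.ne (G := cherryCompl x y z) h)
  have hmem : ∀ e : (completeEquipartiteGraph r t).edgeSet,
      (e : Sym2 (Fin r × Fin t)) ∈ (blowUp (cherryCompl x y z) t).edgeSet →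
      cherryColoring x y z t e = {u | u ∈ (e : Sym2 (Fin r × Fin t))} := by
    intro e he
    simp [cherryColoring, he]
  have hnotMem : ∀ e : (completeEquipartiteGraph r t).edgeSet,
      (e : Sym2 (Fin r × Fin t)) ∉ (blowUp (cherryCompl x y z) t).edgeSet →
      ∃ s, cherryColoring x y z t e = {(x, s)} := by
    intro e he
    obtain ⟨s, s', w, hw, hs⟩ := notMem_blowUp_cherryCompl he
    refine ⟨s, cherryColoring_of_notMem ?_ he hs⟩
    rcases hw with rfl | rfl <;> assumption
  rw [numColors_eq_add hle, ncard_edgeSet_blowUp, ncard_edgeSet_cherryCompl hxy hxz hyz]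
  · congr 1
    have : cherryColoring x y z t '' {e | (e : Sym2 (Fin r × Fin t)) ∉
        (blowUp (cherryCompl x y z) t).edgeSet} = Set.range fun s : Fin t => {(x, s)} := by
      ext A
      constructor
      · rintro ⟨e, he, rfl⟩
        obtain ⟨s, hs⟩ := hnotMem e he
        exact ⟨s, hs.symm⟩
      · rintro ⟨s, rfl⟩
        let e : (completeEquipartiteGraph r t).edgeSet := ⟨s((x, s), (y, s)), hxy⟩
        have he : (e : Sym2 (Fin r × Fin t)) ∉ (blowUp (cherryCompl x y z) t).edgeSet :=
          fun h => (cherryCompl_adj.1 h).2 (.inl rfl)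
        exact ⟨e, he, cherryColoring_of_notMem hxy he rfl⟩
    rw [this, ← Set.image_univ, Set.ncard_image_of_injective, Set.ncard_univ,
      Nat.card_eq_fintype_card, Fintype.card_fin]
    intro s s' h
    simpa using h
  · intro e e' he h
    rw [hmem e he] at h
    by_cases he' : (e' : Sym2 (Fin r × Fin t)) ∈ (blowUp (cherryCompl x y z) t).edgeSet
    · rw [hmem e' he'] at h
      exact Subtype.ext (Sym2.ext fun u => Set.ext_iff.1 h u)
    · obtain ⟨s, hs⟩ := hnotMem e' he'
      rw [hs] at h
      obtain ⟨e, he₁⟩ := e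
      induction e with | _ u v =>
      have hu : u = (x, s) := (Set.ext_iff.1 h u).1 (Sym2.mem_mk_left u v)
      have hv : v = (x, s) := (Set.ext_iff.1 h v).1 (Sym2.mem_mk_right u v)
      exact absurd (hu.trans hv.symm) (mem_edgeSet _ |>.1 he₁).ne

/-- A copy of `K_r` meets each of the `r` parts exactly once, so its edges over `xy` and `xz` share
their end over `x`, hence their color. -/
theorem not_hasRainbowCopy_cherryColoring {x y z : Fin r} (hxy : x ≠ y) (hxz : x ≠ z)
    (hyz : y ≠ z) : ¬ HasRainbowCopy (cherryColoring x y z t) (completeGraph (Fin r)) := by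
  rintro ⟨f, hf⟩
  have hinj : Function.Injective fun i => (f i).1 := by
    intro i j hij
    by_contra hne
    exact (f.toHom.map_adj (show (completeGraph (Fin r)).Adj i j from hne)) hij
  have hsurj := Finite.surjective_of_injective hinj
  obtain ⟨i, hi⟩ := hsurj x
  obtain ⟨j, hj⟩ := hsurj y
  obtain ⟨l, hl⟩ := hsurj z
  simp only at hi hj hl
  have key : ∀ w p (hip : i ≠ p), x ≠ w → (w = y ∨ w = z) → (f p).1 = w →
      (cherryColoring x y z t).pullback f.toHom ⟨s(i, p), hip⟩ = {(x, (f i).2)} := by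
    rintro w p hip hxw hw rfl
    refine cherryColoring_of_notMem (s' := (f p).2) hxw ?_ ?_
    · intro h
      refine (cherryCompl_adj (u := (f i).1) (v := (f p).1).1 h).2 ?_
      rw [hi]
      rcases hw with h | h <;> simp [h]
    · change s(f i, f p) = _
      rw [← hi]
  have hij : i ≠ j := by rintro rfl; exact hxy (hi.symm.trans hj)
  have hil : i ≠ l := by rintro rfl; exact hxz (hi.symm.trans hl)
  have := congrArg Subtype.val (hf ((key y j hij hxy (.inl rfl) hj).trans
    (key z l hil hxz (.inr rfl) hl).symm))
  obtain rfl : j = l := by simpa [hil] using this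
  exact hyz (hj.symm.trans hl)

end Cherry

end LowerBound

end AntiRamsey

theorem mainTheorem2 (r k t : ℕ) (hk : 4 ≤ k) (hkr : k ≤ r) (ht : 1 ≤ t) :
    (r = k →
      AntiRamsey.antiRamseyNumber (SimpleGraph.completeEquipartiteGraph r t)
          (SimpleGraph.completeGraph (Fin k))
        = t ^ 2 * (k.choose 2 - 2) + t) ∧
    (k < r →
      AntiRamsey.antiRamseyNumber (SimpleGraph.completeEquipartiteGraph r t)
          (SimpleGraph.completeGraph (Fin k))
        = t ^ 2 * SimpleGraph.extremalNumber r (SimpleGraph.completeGraph (Fin (k - 1))) + 1 ∧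
      (∃ c : (SimpleGraph.completeGraph (Fin r)).EdgeLabeling ℕ,
        AntiRamsey.IsTuranColoring (k - 2) c) ∧
      ∀ c : (SimpleGraph.completeGraph (Fin r)).EdgeLabeling ℕ,
        AntiRamsey.IsTuranColoring (k - 2) c →
          ¬ AntiRamsey.HasRainbowCopy
              (G := SimpleGraph.completeEquipartiteGraph r t)
              (AntiRamsey.blowUpColoring c t) (SimpleGraph.completeGraph (Fin k)) ∧
          AntiRamsey.numColors
              (G := SimpleGraph.completeEquipartiteGraph r t)
              (AntiRamsey.blowUpColoring c t)
            = t ^ 2 * SimpleGraph.extremalNumber r (SimpleGraph.completeGraph (Fin (k - 1))) + 1) := by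
  constructor
  · rintro rfl
    let x : Fin r := ⟨0, by omega⟩
    let y : Fin r := ⟨1, by omega⟩
    let z : Fin r := ⟨2, by omega⟩
    have hxy : x ≠ y := by simp [x, y]
    have hxz : x ≠ z := by simp [x, z]
    have hyz : y ≠ z := by simp [y, z]
    exact AntiRamsey.antiRamseyNumber_eq (fun c hc => AntiRamsey.numColors_le_of_eq ht hc)
      (AntiRamsey.cherryColoring x y z t)
      (AntiRamsey.not_hasRainbowCopy_cherryColoring hxy hxz hyz)
      (AntiRamsey.numColors_cherryColoring hxy hxz hyz)
  · intro hlt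
    obtain ⟨m, rfl⟩ : ∃ m, k = m + 2 := ⟨k - 2, by omega⟩
    simp only [Nat.add_sub_cancel]
    rw [AntiRamsey.extremalNumber_completeGraph (by omega)]
    have hex := AntiRamsey.exists_isTuranColoring r m
    have hblow := fun (c : (SimpleGraph.completeGraph (Fin r)).EdgeLabeling ℕ)
      (hc : AntiRamsey.IsTuranColoring m c) =>
        AntiRamsey.blowUp_turanColoring (by omega) hlt ht hc
    refine ⟨?_, hex, hblow⟩
    obtain ⟨c, hc⟩ := hex
    exact AntiRamsey.antiRamseyNumber_eq
      (fun c hc => AntiRamsey.numColors_le_of_lt ht (by omega) hlt hc) _ (hblow c hc).1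
      (hblow c hc).2
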